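/- Theorem 4.1 (Fundamental Theorem of Calculus for right regulated mappings). Let $E$ be a real Banach space, let $I\subset\mathbb R\cup\{\infty\}$ be an interval with $-\infty<\min I<\sup I\le\infty$ (in particular $\min I\in I$ is a real number, while $\sup I$ may or may not belong to $I$), and put $J=I\cap\mathbb R$. Let $g:I\to E$ be right regulated, i.e. $g$ has a right limit in $E$ at every point of $I\setminus\{\sup I\}$. Definitions. A property holds *locally* if it holds on every compact interval $[c,d]\subset J$ with $c<d$. A *tagged division* of $[c,d]$ consists of points $c=t_0\le t_1\le\dots\le t_m=d$ and tags $\xi_i\in[t_{i-1},t_i]$; it is *$\delta$-fine* for a positive function $\delta$ on $[c,d]$ if $[t_{i-1},t_i]\subset(\xi_i-\delta(\xi_i),\xi_i+\delta(\xi_i))$ for $i=1,\dots,m$. The mapping $g$ is *HL (Henstock–Lebesgue) integrable* on $[c,d]$ if there is $f:[c,d]\to E$ such that for every $\epsilon>0$ there is $\delta:[c,d]\to(0,\infty)$ with $$\sum_{i=1}^m\big\|f(t_i)-f(t_{i-1})-(t_i-t_{i-1})g(\xi_i)\big\|<\epsilon$$ for every $\delta$-fine tagged division of $[c,d]$. It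 is *Riemann integrable* on $[c,d]$ if there is $f:[c,d]\to E$ such that for every $\epsilon>0$ there is a constant $\delta>0$ with $$\Big\|\sum_{i=1}^m\big(f(t_i)-f(t_{i-1})-(t_i-t_{i-1})g(\xi_i)\big)\Big\|<\epsilon$$ for every $\delta$-fine tagged division of $[c,d]$. It is *Bochner integrable* on $[c,d]$ if it is strongly measurable (with respect to Lebesgue measure) on $[c,d]$ and $\int_c^d\|g(t)\|\,dt<\infty$. A *CD primitive* of $g$ is a continuous mapping $f:J\to E$ for which there is a countable set $Z\subset J$ such that $f$ is differentiable (relative to $J$) with $f'(t)=g(t)$ at each $t\in J\setminus Z$. Then: (a) $g$ is locally HL integrable if and only if it has a CD primitive. (b) $g$ is locally Bochner integrable if and only if it has a locally absolutely continuous CD primitive. (c) $g$ is locally Riemann integrable if and only if it is locally bounded, in which case $g$ has a locally Lipschitz continuous CD primitive. -/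

import Mathlib

open Set Filter Topology MeasureTheory

namespace RightRegulated

/-- The real points of a set `I` of extended reals. -/
def realPart (I : Set EReal) : Set ℝ := {t : ℝ | (t : EReal) ∈ I}

/-- `g : I → E` is right regulated: it has a right limit in `E` at every point of
`I \ {sup I}`. -/
def IsRightRegulated {E : Type*} [TopologicalSpace E] (I : Set EReal) (g : EReal → E) : Prop :=
  ∀ t ∈ I, t ≠ sSup I → ∃ l : E, Tendsto g (𝓝[>] t) (𝓝 l)

/-- A property of compact real intervals `[c, d]` holds locally on `J` if it holds for all
compact subintervals of `J`. -/
def Locally (J : Set ℝ) (P : ℝ → ℝ → Prop) : Prop :=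
  ∀ c d : ℝ, c < d → Icc c d ⊆ J → P c d

/-- The points `t 0, …, t m` and tags `ξ 1, …, ξ m` (indexed here as `ξ 0, …, ξ (m - 1)`) form
a tagged division of `[a, b]` that is fine for the gauge `δ`:
`ξ i ∈ [t i, t (i + 1)] ⊆ (ξ i - δ (ξ i), ξ i + δ (ξ i))`. -/
structure IsFineDivision (a b : ℝ) (δ : ℝ → ℝ) (m : ℕ) (t ξ : ℕ → ℝ) : Prop where
  left : t 0 = a
  right : t m = b
  le : ∀ i < m, t i ≤ t (i + 1)
  tag_mem : ∀ i < m, ξ i ∈ Icc (t i) (t (i + 1))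
  fine : ∀ i < m, Icc (t i) (t (i + 1)) ⊆ Ioo (ξ i - δ (ξ i)) (ξ i + δ (ξ i))

section

variable {E : Type*} [NormedAddCommGroup E] [NormedSpace ℝ E]

/-- Henstock–Lebesgue integrability of `g` on `[a, b]`. -/
def HLIntegrableOn (g : ℝ → E) (a b : ℝ) : Prop :=
  ∃ f : ℝ → E, ∀ ε > 0, ∃ δ : ℝ → ℝ, (∀ x ∈ Icc a b, 0 < δ x) ∧
    ∀ (m : ℕ) (t ξ : ℕ → ℝ), IsFineDivision a b δ m t ξ →
      ∑ i ∈ Finset.range m,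
        ‖f (t (i + 1)) - f (t i) - (t (i + 1) - t i) • g (ξ i)‖ < ε

/-- Riemann integrability of `g` on `[a, b]`: the norm is outside the sum and the gauge is a
positive constant. -/
def RiemannIntegrableOn (g : ℝ → E) (a b : ℝ) : Prop :=
  ∃ f : ℝ → E, ∀ ε > 0, ∃ δ : ℝ, 0 < δ ∧
    ∀ (m : ℕ) (t ξ : ℕ → ℝ), IsFineDivision a b (fun _ => δ) m t ξ →
      ‖∑ i ∈ Finset.range m,
        (f (t (i + 1)) - f (t i) - (t (i + 1) - t i) • g (ξ i))‖ < ε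

/-- `f` is a CD primitive of `g` on the real interval `J`: it is continuous on `J`, and it is
differentiable with derivative `g` outside a countable subset of `J`. -/
def IsCDPrimitive (J : Set ℝ) (g f : ℝ → E) : Prop :=
  ContinuousOn f J ∧
    ∃ Z : Set ℝ, Z ⊆ J ∧ Z.Countable ∧ ∀ t ∈ J \ Z, HasDerivWithinAt f (g t) J t

/-- Local HL integrability on `J`. -/
def LocallyHLIntegrable (J : Set ℝ) (g : ℝ → E) : Prop :=
  Locally J fun c d => HLIntegrableOn g c d

/-- Local Bochner integrability on `J`. -/
def LocallyBochnerIntegrable (J : Set ℝ) (g : ℝ → E) : Prop :=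
  Locally J fun c d => IntegrableOn g (Icc c d) volume

/-- Local Riemann integrability on `J`. -/
def LocallyRiemannIntegrable (J : Set ℝ) (g : ℝ → E) : Prop :=
  Locally J fun c d => RiemannIntegrableOn g c d

/-- Boundedness on all compact subintervals of `J`. -/
def LocallyBdd (J : Set ℝ) (g : ℝ → E) : Prop :=
  Locally J fun c d => ∃ M : ℝ, ∀ t ∈ Icc c d, ‖g t‖ ≤ M

/-- Absolute continuity on all compact subintervals of `J`. -/
def LocallyAC (J : Set ℝ) (f : ℝ → E) : Prop :=
  Locally J fun c d => AbsolutelyContinuousOnInterval f c d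

/-- Lipschitz continuity on all compact subintervals of `J`. -/
def LocallyLip (J : Set ℝ) (f : ℝ → E) : Prop :=
  Locally J fun c d => ∃ K : NNReal, LipschitzOnWith K f (Icc c d)

end

end RightRegulated

/-! A function on `ℝ` has only countably many discontinuities at which a right limit exists. So `g`
is continuous at the points of `J` off a countable set `Z`, which can also absorb the endpoints of
`J` (`exists_countable_exceptional`). The rest concerns functions continuous off a countable set.

(a) An HL primitive satisfies a mean value inequality, hence has derivative `g` where `g` is
continuous. Conversely, a CD primitive is an HL primitive: a gauge controls each point of
differentiability, and at the countably many other points continuity is played against the jumps of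
an auxiliary monotone function.

(b) The integral from `a` is the primitive. Conversely, the norm of the derivative of an absolutely
continuous function is at most the derivative of its variation, which is integrable because the
variation is monotone.

(c) Moving a single tag shows that Riemann integrable functions are bounded. If `g` is bounded, `Z`
is covered by an open set of small measure, and a Lebesgue number supplies the constant gauge. -/

namespace RightRegulated

/-! ### Tagged divisions and Cousin's lemma -/

section Divisions

lemma IsFineDivision.apply_le_apply {a b : ℝ} {δ : ℝ → ℝ} {m : ℕ} {t ξ : ℕ → ℝ}
    (h : IsFineDivision a b δ m t ξ) {i j : ℕ} (hij : i ≤ j) (hj : j ≤ m) : t i ≤ t j := by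
  induction j, hij using Nat.le_induction with
  | base => exact le_rfl
  | succ k hk ih => exact (ih (by omega)).trans (h.le k (by omega))

lemma IsFineDivision.mem_Icc {a b : ℝ} {δ : ℝ → ℝ} {m : ℕ} {t ξ : ℕ → ℝ}
    (h : IsFineDivision a b δ m t ξ) {i : ℕ} (hi : i ≤ m) : t i ∈ Icc a b :=
  ⟨h.left ▸ h.apply_le_apply (Nat.zero_le i) hi, h.right ▸ h.apply_le_apply hi le_rfl⟩

lemma IsFineDivision.tag_mem_Icc {a b : ℝ} {δ : ℝ → ℝ} {m : ℕ} {t ξ : ℕ → ℝ}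
    (h : IsFineDivision a b δ m t ξ) {i : ℕ} (hi : i < m) : ξ i ∈ Icc a b :=
  ⟨(h.mem_Icc hi.le).1.trans (h.tag_mem i hi).1, (h.tag_mem i hi).2.trans (h.mem_Icc hi).2⟩

/-- Concatenation of two tagged divisions, together with the additivity of the sums. -/
lemma IsFineDivision.append {M : Type*} [AddCommMonoid M] (F : ℝ → ℝ → ℝ → M)
    {a b c : ℝ} {δ : ℝ → ℝ} {m n : ℕ} {t ξ t' ξ' : ℕ → ℝ}
    (h : IsFineDivision a b δ m t ξ) (h' : IsFineDivision b c δ n t' ξ') :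
    ∃ t'' ξ'' : ℕ → ℝ, IsFineDivision a c δ (m + n) t'' ξ'' ∧
      ∑ i ∈ Finset.range (m + n), F (t'' i) (t'' (i + 1)) (ξ'' i) =
        ∑ i ∈ Finset.range m, F (t i) (t (i + 1)) (ξ i) +
        ∑ i ∈ Finset.range n, F (t' i) (t' (i + 1)) (ξ' i) := by
  -- At the junction `i = m` the second branch applies, and `T m = t' 0 = b = t m`.
  set T : ℕ → ℝ := fun i => if i < m then t i else t' (i - m) with hT
  set X : ℕ → ℝ := fun i => if i < m then ξ i else ξ' (i - m) with hX
  have T1 : ∀ i ≤ m, T i = t i := by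
    intro i hi
    rcases hi.lt_or_eq with hi | rfl
    · simp [hT, hi]
    · simp [hT, h.right, h'.left]
  have T2 : ∀ j, T (m + j) = t' j := fun j => by simp [hT]
  have X1 : ∀ i < m, X i = ξ i := fun i hi => by simp [hX, hi]
  have X2 : ∀ j, X (m + j) = ξ' j := fun j => by simp [hX]
  have key : ∀ P : ℝ → ℝ → ℝ → Prop, (∀ i < m, P (t i) (t (i + 1)) (ξ i)) →
      (∀ i < n, P (t' i) (t' (i + 1)) (ξ' i)) → ∀ i < m + n, P (T i) (T (i + 1)) (X i) := by
    intro P h1 h2 i hi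
    rcases lt_or_ge i m with him | him
    · rw [T1 i him.le, T1 (i + 1) him, X1 i him]; exact h1 i him
    · obtain ⟨j, rfl⟩ := Nat.exists_eq_add_of_le him
      rw [T2, X2, add_assoc, T2]; exact h2 j (by omega)
  refine ⟨T, X, ⟨?_, ?_, ?_, ?_, ?_⟩, ?_⟩
  · rw [T1 0 (Nat.zero_le m), h.left]
  · rw [T2, h'.right]
  · exact key (fun u v _ => u ≤ v) h.le h'.le
  · exact key (fun u v x => x ∈ Icc u v) h.tag_mem h'.tag_mem
  · exact key (fun u v x => Icc u v ⊆ Ioo (x - δ x) (x + δ x)) h.fine h'.fine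
  · rw [Finset.sum_range_add]
    congr 1
    · refine Finset.sum_congr rfl fun i hi => ?_
      have hi := Finset.mem_range.1 hi
      rw [T1 i hi.le, T1 (i + 1) hi, X1 i hi]
    · refine Finset.sum_congr rfl fun i _ => ?_
      rw [T2, X2, add_assoc, T2]

lemma isFineDivision_single {u v x : ℝ} {δ : ℝ → ℝ} (hu : u ≤ x) (hv : x ≤ v)
    (h1 : x - δ x < u) (h2 : v < x + δ x) :
    IsFineDivision u v δ 1 (fun i => if i = 0 then u else v) (fun _ => x) := by
  refine ⟨by simp, by simp, ?_, ?_, ?_⟩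
  · intro i hi
    obtain rfl : i = 0 := by omega
    simpa using hu.trans hv
  · intro i hi
    obtain rfl : i = 0 := by omega
    simpa using ⟨hu, hv⟩
  · intro i hi
    obtain rfl : i = 0 := by omega
    simpa using Icc_subset_Ioo h1 h2

/-- **Cousin's lemma**. -/
lemma exists_isFineDivision {a b : ℝ} (hab : a ≤ b) {δ : ℝ → ℝ} (hδ : ∀ x ∈ Icc a b, 0 < δ x) :
    ∃ (m : ℕ) (t ξ : ℕ → ℝ), IsFineDivision a b δ m t ξ := by
  set S : Set ℝ := {x | x ∈ Icc a b ∧ ∃ (m : ℕ) (t ξ : ℕ → ℝ), IsFineDivision a x δ m t ξ}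
    with hS
  have step : ∀ x ∈ S, ∀ y ∈ Icc a b, ∀ z ∈ Icc x y, z - δ z < x → y < z + δ z → y ∈ S := by
    rintro x ⟨-, m, t, ξ, h⟩ y hy z hz h1 h2
    obtain ⟨T, X, hTX, -⟩ := h.append (fun _ _ _ => (0 : ℕ))
      (isFineDivision_single hz.1 hz.2 h1 h2)
    exact ⟨hy, _, T, X, hTX⟩
  have haS : a ∈ S := by
    refine ⟨⟨le_rfl, hab⟩, 0, fun _ => a, fun _ => a, rfl, rfl, ?_, ?_, ?_⟩ <;> simp
  have hbdd : BddAbove S := ⟨b, fun x hx => hx.1.2⟩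
  set s := sSup S with hs
  have has : a ≤ s := le_csSup hbdd haS
  have hsb : s ≤ b := csSup_le ⟨a, haS⟩ fun x hx => hx.1.2
  have hδs : 0 < δ s := hδ s ⟨has, hsb⟩
  obtain ⟨x, hxS, hx⟩ := exists_lt_of_lt_csSup ⟨a, haS⟩ (show s - δ s < s by linarith)
  have hxs : x ≤ s := le_csSup hbdd hxS
  -- One piece `[x, y]` tagged at `s` carries the division past `s` unless `s = b`; since `y ≤ s`,
  -- only `y = b` remains.
  set y := min b (s + δ s / 2) with hy
  have hsy : s ≤ y := le_min hsb (by linarith)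
  have hyS : y ∈ S := step x hxS y ⟨has.trans hsy, min_le_left _ _⟩ s ⟨hxs, hsy⟩ hx
    ((min_le_right _ _).trans_lt (by linarith))
  have hys : y ≤ s := le_csSup hbdd hyS
  have : y = b := by
    rcases min_choice b (s + δ s / 2) with h | h
    · exact h
    · rw [← hy] at h; linarith
  exact (this ▸ hyS).2

/-- A division of a subinterval extends to the whole interval. -/
lemma IsFineDivision.exists_extend {M : Type*} [AddCommMonoid M] (F : ℝ → ℝ → ℝ → M)
    {c d : ℝ} {δ : ℝ → ℝ} (hδ : ∀ x ∈ Icc c d, 0 < δ x) {x y : ℝ} (hx : x ∈ Icc c d)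
    (hy : y ∈ Icc c d) :
    ∃ A B : M, ∀ {m : ℕ} {t ξ : ℕ → ℝ}, IsFineDivision x y δ m t ξ →
      ∃ (n : ℕ) (T X : ℕ → ℝ), IsFineDivision c d δ n T X ∧
        ∑ i ∈ Finset.range n, F (T i) (T (i + 1)) (X i) =
          A + ∑ i ∈ Finset.range m, F (t i) (t (i + 1)) (ξ i) + B := by
  -- The outer divisions are fixed before the middle one, so `A` and `B` cancel when two middle
  -- divisions are compared.
  obtain ⟨m₁, t₁, ξ₁, h₁⟩ := exists_isFineDivision hx.1 (δ := δ)
    fun z hz => hδ z ⟨hz.1, hz.2.trans hx.2⟩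
  obtain ⟨m₂, t₂, ξ₂, h₂⟩ := exists_isFineDivision hy.2 (δ := δ)
    fun z hz => hδ z ⟨hy.1.trans hz.1, hz.2⟩
  refine ⟨∑ i ∈ Finset.range m₁, F (t₁ i) (t₁ (i + 1)) (ξ₁ i),
    ∑ i ∈ Finset.range m₂, F (t₂ i) (t₂ (i + 1)) (ξ₂ i), fun {m t ξ} h => ?_⟩
  obtain ⟨T, X, hT, e⟩ := h₁.append F h
  obtain ⟨T', X', hT', e'⟩ := hT.append F h₂
  exact ⟨_, T', X', hT', by rw [e', e]⟩

end Divisions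

/-! ### Henstock–Lebesgue primitives -/

section HenstockLebesgue

variable {E : Type*} [NormedAddCommGroup E] [NormedSpace ℝ E]

/-- `f` is an HL primitive of `g` on `[a, b]`. -/
def IsHLPrimitive (g f : ℝ → E) (a b : ℝ) : Prop :=
  ∀ ε > 0, ∃ δ : ℝ → ℝ, (∀ x ∈ Icc a b, 0 < δ x) ∧
    ∀ (m : ℕ) (t ξ : ℕ → ℝ), IsFineDivision a b δ m t ξ →
      ∑ i ∈ Finset.range m,
        ‖f (t (i + 1)) - f (t i) - (t (i + 1) - t i) • g (ξ i)‖ < ε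

/-- A gauge that works on `[a, b]` works on all subintervals. -/
lemma IsHLPrimitive.exists_gauge {g f : ℝ → E} {a b : ℝ} (h : IsHLPrimitive g f a b)
    {ε : ℝ} (hε : 0 < ε) : ∃ δ : ℝ → ℝ, (∀ x ∈ Icc a b, 0 < δ x) ∧
      ∀ x ∈ Icc a b, ∀ y ∈ Icc a b, ∀ (m : ℕ) (t ξ : ℕ → ℝ), IsFineDivision x y δ m t ξ →
      ∑ i ∈ Finset.range m,
        ‖f (t (i + 1)) - f (t i) - (t (i + 1) - t i) • g (ξ i)‖ < ε := by
  obtain ⟨δ, hδ, H⟩ := h ε hε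
  refine ⟨δ, hδ, fun x hx y hy m t ξ hd => ?_⟩
  obtain ⟨m₁, t₁, ξ₁, h₁⟩ := exists_isFineDivision hx.1 (δ := δ)
    fun z hz => hδ z ⟨hz.1, hz.2.trans hx.2⟩
  obtain ⟨m₂, t₂, ξ₂, h₂⟩ := exists_isFineDivision hy.2 (δ := δ)
    fun z hz => hδ z ⟨hy.1.trans hz.1, hz.2⟩
  obtain ⟨T, X, hT, e⟩ := h₁.append (fun u v x => ‖f v - f u - (v - u) • g x‖) hd
  obtain ⟨T', X', hT', e'⟩ := hT.append (fun u v x => ‖f v - f u - (v - u) • g x‖) h₂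
  have := H _ _ _ hT'
  rw [e', e] at this
  -- The norms stand inside the sum, so the outer pieces can simply be dropped.
  have p₁ : 0 ≤ ∑ i ∈ Finset.range m₁,
      ‖f (t₁ (i + 1)) - f (t₁ i) - (t₁ (i + 1) - t₁ i) • g (ξ₁ i)‖ := by positivity
  have p₂ : 0 ≤ ∑ i ∈ Finset.range m₂,
      ‖f (t₂ (i + 1)) - f (t₂ i) - (t₂ (i + 1) - t₂ i) • g (ξ₂ i)‖ := by positivity
  linarith

lemma IsFineDivision.mono_gauge {a b : ℝ} {δ δ' : ℝ → ℝ} {m : ℕ} {t ξ : ℕ → ℝ}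
    (h : IsFineDivision a b δ m t ξ) (hδ : ∀ x ∈ Icc a b, δ x ≤ δ' x) :
    IsFineDivision a b δ' m t ξ :=
  ⟨h.left, h.right, h.le, h.tag_mem, fun i hi => (h.fine i hi).trans
    (Ioo_subset_Ioo (by linarith [hδ _ (h.tag_mem_Icc hi)])
      (by linarith [hδ _ (h.tag_mem_Icc hi)]))⟩

lemma IsFineDivision.sum_sub {a b : ℝ} {δ : ℝ → ℝ} {m : ℕ} {t ξ : ℕ → ℝ}
    (h : IsFineDivision a b δ m t ξ) {M : Type*} [AddCommGroup M] (f : ℝ → M) :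
    ∑ i ∈ Finset.range m, (f (t (i + 1)) - f (t i)) = f b - f a := by
  rw [Finset.sum_range_sub (fun i => f (t i)), h.left, h.right]

/-- Increments of HL primitives are determined by the integrand. -/
lemma IsHLPrimitive.sub_eq_sub {g f f' : ℝ → E} {a b a' b' x y : ℝ}
    (h : IsHLPrimitive g f a b) (h' : IsHLPrimitive g f' a' b') (hxy : x ≤ y)
    (hx : x ∈ Icc a b) (hy : y ∈ Icc a b) (hx' : x ∈ Icc a' b') (hy' : y ∈ Icc a' b') :
    f y - f x = f' y - f' x := by
  refine eq_of_forall_dist_le fun ε hε => ?_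
  obtain ⟨δ, hδ, H⟩ := h.exists_gauge (half_pos hε)
  obtain ⟨δ', hδ', H'⟩ := h'.exists_gauge (half_pos hε)
  obtain ⟨m, t, ξ, hd⟩ := exists_isFineDivision hxy (δ := fun z => min (δ z) (δ' z))
    fun z hz => lt_min (hδ z ⟨hx.1.trans hz.1, hz.2.trans hy.2⟩)
      (hδ' z ⟨hx'.1.trans hz.1, hz.2.trans hy'.2⟩)
  have s := H x hx y hy m t ξ (hd.mono_gauge fun z _ => min_le_left _ _)
  have s' := H' x hx' y hy' m t ξ (hd.mono_gauge fun z _ => min_le_right _ _)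
  rw [dist_eq_norm, ← hd.sum_sub f, ← hd.sum_sub f', ← Finset.sum_sub_distrib]
  calc _ = ‖∑ i ∈ Finset.range m, ((f (t (i + 1)) - f (t i) - (t (i + 1) - t i) • g (ξ i))
          - (f' (t (i + 1)) - f' (t i) - (t (i + 1) - t i) • g (ξ i)))‖ := by
        congr 1; refine Finset.sum_congr rfl fun i _ => by abel
    _ ≤ ∑ i ∈ Finset.range m, (‖f (t (i + 1)) - f (t i) - (t (i + 1) - t i) • g (ξ i)‖ +
          ‖f' (t (i + 1)) - f' (t i) - (t (i + 1) - t i) • g (ξ i)‖) :=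
        (norm_sum_le _ _).trans (Finset.sum_le_sum fun i _ => norm_sub_le _ _)
    _ ≤ ε := by rw [Finset.sum_add_distrib]; linarith

/-- Mean value estimate for HL primitives. -/
lemma IsHLPrimitive.norm_sub_sub_smul_le {g f : ℝ → E} {a b x y η : ℝ} {l : E}
    (h : IsHLPrimitive g f a b) (hxy : x ≤ y) (hx : x ∈ Icc a b) (hy : y ∈ Icc a b)
    (hη : ∀ z ∈ Icc x y, ‖g z - l‖ ≤ η) : ‖f y - f x - (y - x) • l‖ ≤ η * (y - x) := by
  refine le_of_forall_pos_le_add fun ε hε => ?_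
  obtain ⟨δ, hδ, H⟩ := h.exists_gauge hε
  obtain ⟨m, t, ξ, hd⟩ := exists_isFineDivision hxy (δ := δ)
    fun z hz => hδ z ⟨hx.1.trans hz.1, hz.2.trans hy.2⟩
  have s := H x hx y hy m t ξ hd
  have e1 := hd.sum_sub f
  have e2 := hd.sum_sub (fun z : ℝ => z • l)
  have e3 := hd.sum_sub (fun z : ℝ => η * z)
  rw [sub_smul, mul_sub, ← e1, ← e2, ← e3, ← Finset.sum_sub_distrib]
  calc _ ≤ ∑ i ∈ Finset.range m, ((η * t (i + 1) - η * t i) +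
          ‖f (t (i + 1)) - f (t i) - (t (i + 1) - t i) • g (ξ i)‖) := by
        refine (norm_sum_le _ _).trans (Finset.sum_le_sum fun i hi => ?_)
        have hi := Finset.mem_range.1 hi
        have ht : 0 ≤ t (i + 1) - t i := sub_nonneg.2 (hd.le i hi)
        have : f (t (i + 1)) - f (t i) - (t (i + 1) • l - t i • l) =
            (t (i + 1) - t i) • (g (ξ i) - l) +
            (f (t (i + 1)) - f (t i) - (t (i + 1) - t i) • g (ξ i)) := by
          rw [smul_sub, ← sub_smul]; abel
        rw [this]
        refine (norm_add_le _ _).trans (add_le_add_left ?_ _)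
        rw [norm_smul, Real.norm_of_nonneg ht, ← mul_sub, mul_comm]
        exact mul_le_mul_of_nonneg_right (hη _ (hd.tag_mem_Icc hi)) ht
    _ ≤ _ := by rw [Finset.sum_add_distrib]; linarith

/-- A one-piece division tagged at `x` already bounds `f y - f x` by `ε / 2 + |y - x| * ‖g x‖`. -/
lemma IsHLPrimitive.continuousOn {g f : ℝ → E} {a b : ℝ} (h : IsHLPrimitive g f a b) :
    ContinuousOn f (Icc a b) := by
  intro x hx
  rw [Metric.continuousWithinAt_iff]
  intro ε hε
  obtain ⟨δ, hδ, H⟩ := h.exists_gauge (half_pos hε)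
  have hδx := hδ x hx
  have key : ∀ u v, u ∈ Icc a b → v ∈ Icc a b → u ≤ x → x ≤ v → x - δ x < u → v < x + δ x →
      ‖f v - f u - (v - u) • g x‖ < ε / 2 := by
    intro u v hu hv hux hxv h1 h2
    simpa using H u hu v hv _ _ _ (isFineDivision_single hux hxv h1 h2)
  refine ⟨min (δ x) (ε / 2 / (‖g x‖ + 1)), lt_min hδx (by positivity), fun {y} hy hyx => ?_⟩
  rw [Real.dist_eq, lt_min_iff, lt_div_iff₀ (by positivity)] at hyx
  obtain ⟨h1, h2⟩ := hyx
  have h3 : |y - x| * ‖g x‖ ≤ ε / 2 := by nlinarith [abs_nonneg (y - x)]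
  have h4 : ‖f y - f x - (y - x) • g x‖ < ε / 2 := by
    rw [abs_lt] at h1
    rcases le_total x y with hxy | hxy
    · exact key x y hx hy le_rfl hxy (by linarith) (by linarith)
    · have := key y x hy hx hxy le_rfl (by linarith) (by linarith)
      have e : -(f y - f x - (y - x) • g x) = f x - f y - (x - y) • g x := by module
      rwa [← norm_neg, e]
  rw [dist_eq_norm]
  calc ‖f y - f x‖ = ‖(f y - f x - (y - x) • g x) + (y - x) • g x‖ := by rw [sub_add_cancel]
    _ ≤ ‖f y - f x - (y - x) • g x‖ + ‖(y - x) • g x‖ := norm_add_le _ _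
    _ < ε := by rw [norm_smul, Real.norm_eq_abs]; linarith

/-- Near `x` the values of `g` are within `η` of `g x`, so the mean value estimate with `l = g x` is
the required little-o bound. -/
lemma IsHLPrimitive.hasDerivAt {g f : ℝ → E} {a b x : ℝ} (h : IsHLPrimitive g f a b)
    (hx : x ∈ Ioo a b) (hg : ContinuousAt g x) : HasDerivAt f (g x) x := by
  rw [hasDerivAt_iff_isLittleO, Asymptotics.isLittleO_iff]
  intro η hη
  obtain ⟨r, hr, H⟩ := Metric.continuousAt_iff.1 hg η hη
  filter_upwards [Metric.ball_mem_nhds x hr, Ioo_mem_nhds hx.1 hx.2] with y hy hyab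
  rw [Metric.mem_ball, Real.dist_eq, abs_lt] at hy
  have H' : ∀ z, |z - x| < r → ‖g z - g x‖ ≤ η := fun z hz => by
    rw [← dist_eq_norm]; exact (H hz).le
  rcases le_total x y with hxy | hxy
  · rw [Real.norm_of_nonneg (sub_nonneg.2 hxy)]
    exact h.norm_sub_sub_smul_le hxy (Ioo_subset_Icc_self hx) (Ioo_subset_Icc_self hyab)
      fun z hz => H' z (abs_lt.2 ⟨by linarith [hz.1], by linarith [hz.2]⟩)
  · have := h.norm_sub_sub_smul_le hxy (Ioo_subset_Icc_self hyab) (Ioo_subset_Icc_self hx)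
      (l := g x) (η := η) fun z hz => H' z (abs_lt.2 ⟨by linarith [hz.1], by linarith [hz.2]⟩)
    have e : -(f y - f x - (y - x) • g x) = f x - f y - (x - y) • g x := by module
    rwa [Real.norm_of_nonpos (sub_nonpos.2 hxy), neg_sub, ← norm_neg, e]

/-- A monotone function whose increments over intervals meeting a countable set are bounded
below. -/
lemma exists_monotone_jump {Z : Set ℝ} (hZ : Z.Countable) : ∃ W : ℝ → ℝ, Monotone W ∧
    ∀ z ∈ Z, ∃ κ > 0, ∀ u v, u ≤ z → z ≤ v → u < v → κ ≤ W v - W u := by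
  obtain ⟨e, he⟩ := countable_iff_exists_subset_range.1 hZ
  set w : ℕ → ℝ := fun k => (1 / 2 : ℝ) ^ k with hw
  have hw0 : ∀ k, 0 < w k := fun k => by positivity
  have hsw : Summable w := summable_geometric_two
  -- Each term jumps by `w k` on both sides of `e k`, so an interval with `e k` as an endpoint still
  -- registers a jump.
  set q : ℝ → ℕ → ℝ := fun t k => (if e k < t then w k else 0) + (if e k ≤ t then w k else 0)
    with hq
  have hs : ∀ t, Summable (q t) := by
    intro t
    refine Summable.add ?_ ?_ <;>
    · refine Summable.of_nonneg_of_le (fun k => ?_) (fun k => ?_) hsw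
      · split_ifs <;> simp [(hw0 k).le]
      · split_ifs <;> simp [(hw0 k).le]
  have hmono : ∀ k, Monotone fun t => q t k := by
    intro k u v huv
    have := (hw0 k).le
    simp only [hq]
    gcongr ?_ + ?_
    · split_ifs <;> linarith
    · split_ifs <;> linarith
  refine ⟨fun t => ∑' k, q t k, fun u v huv =>
    (hs u).tsum_le_tsum (fun k => hmono k huv) (hs v), fun z hz => ?_⟩
  obtain ⟨k, rfl⟩ := he hz
  refine ⟨w k, hw0 k, fun u v hu hv huv => ?_⟩
  simp only
  rw [← (hs v).tsum_sub (hs u)]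
  have h0 : ∀ j, 0 ≤ q v j - q u j := fun j => sub_nonneg.2 (hmono j huv.le)
  refine le_trans ?_ (((hs v).sub (hs u)).le_tsum k fun j _ => h0 j)
  have := (hw0 k).le
  simp only [hq]
  split_ifs <;> linarith

/-- A continuous function which is differentiable off a countable set is an HL primitive of its
derivative. -/
lemma isHLPrimitive_of_hasDerivWithinAt {g f : ℝ → E} {a b : ℝ} (hab : a ≤ b)
    (hf : ContinuousOn f (Icc a b)) {Z : Set ℝ} (hZ : Z.Countable)
    (hd : ∀ x ∈ Icc a b \ Z, HasDerivWithinAt f (g x) (Icc a b) x) : IsHLPrimitive g f a b := by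
  obtain ⟨W, hW, hjump⟩ := exists_monotone_jump hZ
  intro ε hε
  -- The increments of `φ` are the error budget: the identity pays at points of differentiability,
  -- `W` at points of `Z`. The budget telescopes to `η * (φ b - φ a) < ε`.
  set φ : ℝ → ℝ := fun x => x + W x with hφ
  have hφab : 0 ≤ φ b - φ a := by simp only [hφ]; linarith [hW hab]
  set η := ε / (φ b - φ a + 1) with hη
  have hη0 : 0 < η := by positivity
  have local_est : ∀ x, ∃ δ : ℝ, x ∈ Icc a b → 0 < δ ∧ ∀ u ∈ Icc a b, ∀ v ∈ Icc a b,
      u ≤ x → x ≤ v → x - δ < u → v < x + δ →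
        ‖f v - f u - (v - u) • g x‖ ≤ η * (φ v - φ u) := by
    intro x
    by_cases hx : x ∈ Icc a b
    swap
    · exact ⟨0, fun h => absurd h hx⟩
    by_cases hxZ : x ∈ Z
    · obtain ⟨κ, hκ, hjx⟩ := hjump x hxZ
      have hc : ContinuousWithinAt (fun y => f y - y • g x) (Icc a b) x :=
        (hf x hx).sub (by fun_prop)
      obtain ⟨δ, hδ, H⟩ := Metric.continuousWithinAt_iff.1 hc (η * κ / 2) (by positivity)
      refine ⟨δ, fun _ => ⟨hδ, fun u hu v hv hux hxv h1 h2 => ?_⟩⟩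
      rcases (hux.trans hxv).eq_or_lt with rfl | huv
      · simp
      have H1 := H hu (by rw [Real.dist_eq, abs_lt]; constructor <;> linarith)
      have H2 := H hv (by rw [Real.dist_eq, abs_lt]; constructor <;> linarith)
      have H3 := (dist_triangle_right (f v - v • g x) (f u - u • g x) (f x - x • g x)).trans
        (add_lt_add H2 H1).le
      rw [dist_eq_norm] at H3
      have e : f v - f u - (v - u) • g x = f v - v • g x - (f u - u • g x) := by
        rw [sub_smul]; abel
      rw [e]
      refine H3.trans ?_
      have := hjx u v hux hxv huv
      have h4 : κ ≤ φ v - φ u := by simp only [hφ]; linarith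
      have := mul_le_mul_of_nonneg_left h4 hη0.le
      linarith
    · have := hasDerivWithinAt_iff_isLittleO.1 (hd x ⟨hx, hxZ⟩)
      have := Asymptotics.isLittleO_iff.1 this hη0
      obtain ⟨δ, hδ, H⟩ := Metric.mem_nhdsWithin_iff.1 this
      refine ⟨δ, fun _ => ⟨hδ, fun u hu v hv hux hxv h1 h2 => ?_⟩⟩
      have H1 := H ⟨by rw [Metric.mem_ball, Real.dist_eq, abs_lt]; constructor <;> linarith, hu⟩
      have H2 := H ⟨by rw [Metric.mem_ball, Real.dist_eq, abs_lt]; constructor <;> linarith, hv⟩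
      simp only [mem_ofPred_eq] at H1 H2
      rw [Real.norm_of_nonpos (sub_nonpos.2 hux)] at H1
      rw [Real.norm_of_nonneg (sub_nonneg.2 hxv)] at H2
      have e : f v - f u - (v - u) • g x =
          (f v - f x - (v - x) • g x) - (f u - f x - (u - x) • g x) := by
        simp only [sub_smul]; abel
      rw [e]
      refine (norm_sub_le _ _).trans ((add_le_add H2 H1).trans ?_)
      rw [← mul_add]
      refine mul_le_mul_of_nonneg_left ?_ hη0.le
      simp only [hφ]; linarith [hW (hux.trans hxv)]
  choose δ hδ using local_est
  refine ⟨δ, fun x hx => (hδ x hx).1, fun m t ξ hdiv => ?_⟩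
  calc _ ≤ ∑ i ∈ Finset.range m, (η * φ (t (i + 1)) - η * φ (t i)) := by
        refine Finset.sum_le_sum fun i hi => ?_
        have hi := Finset.mem_range.1 hi
        have hfine := hdiv.fine i hi
        have ht := hdiv.tag_mem i hi
        rw [← mul_sub]
        exact (hδ (ξ i) (hdiv.tag_mem_Icc hi)).2 _ (hdiv.mem_Icc hi.le) _ (hdiv.mem_Icc hi)
          ht.1 ht.2 (hfine ⟨le_rfl, hdiv.le i hi⟩).1 (hfine ⟨hdiv.le i hi, le_rfl⟩).2
    _ = η * (φ b - φ a) := by rw [hdiv.sum_sub (fun x => η * φ x)]; ring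
    _ < ε := by
        rw [hη, div_mul_eq_mul_div, div_lt_iff₀ (by positivity)]
        nlinarith

end HenstockLebesgue

/-! ### Bochner integrability and absolute continuity -/

section Bochner

variable {E : Type*} [NormedAddCommGroup E] [NormedSpace ℝ E]

lemma aestronglyMeasurable_of_continuousAt {E : Type*} [NormedAddCommGroup E] {g : ℝ → E} {s Z : Set ℝ} (hs : MeasurableSet s)
    (hZ : Z.Countable) (hg : ∀ t ∈ s \ Z, ContinuousAt g t) :
    AEStronglyMeasurable g (volume.restrict s) := by
  have h : AEStronglyMeasurable g (volume.restrict (s \ Z)) :=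
    ContinuousOn.aestronglyMeasurable (fun t ht => (hg t ht).continuousWithinAt)
      (hs.diff hZ.measurableSet)
  rwa [Measure.restrict_congr_set (sdiff_null_ae_eq_self (hZ.measure_zero volume))] at h

lemma integrableOn_Icc_of_bounded {E : Type*} [NormedAddCommGroup E] {g : ℝ → E} {c d M : ℝ}
    {Z : Set ℝ} (hZ : Z.Countable) (hg : ∀ t ∈ Icc c d \ Z, ContinuousAt g t)
    (hM : ∀ t ∈ Icc c d, ‖g t‖ ≤ M) : IntegrableOn g (Icc c d) := by
  refine Integrable.of_bound (aestronglyMeasurable_of_continuousAt measurableSet_Icc hZ hg) M ?_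
  filter_upwards [ae_restrict_mem measurableSet_Icc] with t ht using hM t ht

/-- Increments of the integral are dominated by those of the real function `∫ ‖g‖`, whose absolute
continuity is known. -/
lemma absolutelyContinuousOnInterval_integral {g : ℝ → E} {a c d : ℝ}
    (h : ∀ x ∈ uIcc c d, IntervalIntegrable g volume a x) :
    AbsolutelyContinuousOnInterval (fun x => ∫ s in a..x, g s) c d := by
  have hcd : IntervalIntegrable g volume c d :=
    (h c left_mem_uIcc).symm.trans (h d right_mem_uIcc)
  have hn := hcd.norm.absolutelyContinuousOnInterval_intervalIntegral (c := c) left_mem_uIcc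
  rw [absolutelyContinuousOnInterval_iff] at hn ⊢
  intro ε hε
  obtain ⟨δ, hδ, H⟩ := hn ε hε
  refine ⟨δ, hδ, fun P hP hlen => lt_of_le_of_lt (Finset.sum_le_sum fun i hi => ?_) (H P hP hlen)⟩
  obtain ⟨h1, h2⟩ := hP.1 i hi
  have hc : ∀ x ∈ uIcc c d, IntervalIntegrable (fun s => ‖g s‖) volume c x := fun x hx =>
    hcd.norm.mono_set (uIcc_subset_uIcc_left hx)
  rw [dist_eq_norm, dist_eq_norm,
    intervalIntegral.integral_interval_sub_left (h _ h1) (h _ h2),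
    intervalIntegral.integral_interval_sub_left (hc _ h1) (hc _ h2), Real.norm_eq_abs]
  exact intervalIntegral.norm_integral_le_abs_integral_norm

/-- The derivative of an absolutely continuous function is Bochner integrable. -/
lemma integrableOn_of_absolutelyContinuousOnInterval {g f : ℝ → E} {c d : ℝ} (hcd : c ≤ d)
    (hf : AbsolutelyContinuousOnInterval f c d) {Z : Set ℝ} (hZ : Z.Countable)
    (hd : ∀ x ∈ Icc c d \ Z, HasDerivWithinAt f (g x) (Icc c d) x)
    (hg : AEStronglyMeasurable g (volume.restrict (Icc c d))) :
    IntegrableOn g (Icc c d) := by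
  have hbv : LocallyBoundedVariationOn f (Icc c d) := by
    have := hf.boundedVariationOn
    rw [uIcc_of_le hcd] at this
    exact this.locallyBoundedVariationOn
  have hc : c ∈ Icc c d := left_mem_Icc.2 hcd
  set V : ℝ → ℝ := variationOnFromTo f (Icc c d) c with hV
  have hmono : MonotoneOn V (Icc c d) := variationOnFromTo.monotoneOn hbv hc
  have hint : IntegrableOn (deriv V) (Icc c d) := by
    have := MonotoneOn.intervalIntegrable_deriv (by rwa [uIcc_of_le hcd])
    rwa [intervalIntegrable_iff_integrableOn_Icc_of_le hcd] at this
  have hinc : ∀ x ∈ Icc c d, ∀ y ∈ Icc c d, x ≤ y → ‖f y - f x‖ ≤ V y - V x := by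
    intro x hx y hy hxy
    rw [hV, variationOnFromTo.sub_right hbv hc hy hx, variationOnFromTo.eq_of_le _ _ hxy,
      ← dist_eq_norm, dist_comm, ← ENNReal.ofReal_le_iff_le_toReal (hbv x y hx hy), ← edist_dist]
    exact eVariationOn.edist_le _ ⟨hx, le_rfl, hxy⟩ ⟨hy, hxy, le_rfl⟩
  -- Discarding the endpoints makes both derivatives two-sided, so right slopes suffice for
  -- comparing them.
  have hZ' : ∀ᵐ x ∂volume.restrict (Icc c d), x ∉ Z ∪ {c, d} :=
    ae_restrict_of_ae <| measure_eq_zero_iff_ae_notMem.1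
      ((hZ.union (by simp)).measure_zero volume)
  refine hint.mono' hg ?_
  filter_upwards [hmono.ae_differentiableWithinAt measurableSet_Icc, hZ',
    ae_restrict_mem measurableSet_Icc] with x hx hxZ hxI
  simp only [mem_union, mem_insert_iff, mem_singleton_iff, not_or] at hxZ
  have hxo : x ∈ Ioo c d := ⟨lt_of_le_of_ne hxI.1 (Ne.symm hxZ.2.1), lt_of_le_of_ne hxI.2 hxZ.2.2⟩
  have hnhds : Icc c d ∈ 𝓝 x := Icc_mem_nhds hxo.1 hxo.2
  have h1 := ((hd x ⟨hxI, hxZ.1⟩).hasDerivAt hnhds).hasDerivWithinAt (s := Ioi x)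
  have h2 := (hx.differentiableAt hnhds).hasDerivAt.hasDerivWithinAt (s := Ioi x)
  rw [hasDerivWithinAt_iff_tendsto_slope' self_notMem_Ioi] at h1 h2
  refine le_of_tendsto_of_tendsto h1.norm h2 ?_
  filter_upwards [Ioo_mem_nhdsGT hxo.2] with y hy
  rw [slope_def_field, slope_def_module, norm_smul, Real.norm_of_nonneg (by
    rw [inv_nonneg]; linarith [hy.1]), div_eq_inv_mul]
  exact mul_le_mul_of_nonneg_left (hinc x hxI y ⟨hxI.1.trans hy.1.le, hy.2.le⟩ hy.1.le)
    (by rw [inv_nonneg]; linarith [hy.1])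

end Bochner

/-! ### Riemann integrability and boundedness -/

section Riemann

variable {E : Type*} [NormedAddCommGroup E] [NormedSpace ℝ E]

/-- Riemann integrable functions are bounded. -/
lemma RiemannIntegrableOn.exists_bound {g : ℝ → E} {c d : ℝ} (hcd : c < d)
    (h : RiemannIntegrableOn g c d) : ∃ M : ℝ, ∀ t ∈ Icc c d, ‖g t‖ ≤ M := by
  obtain ⟨f, hf⟩ := h
  obtain ⟨δ, hδ, H⟩ := hf 1 one_pos
  -- Two divisions that differ only in the tag of the piece `[u, v]` have sums of norm less than
  -- `1`, so `(v - u) * ‖g x - g u‖ ≤ 2`.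
  have interval_bound : ∀ u ∈ Icc c d, ∀ v ∈ Icc c d, u < v → v - u < δ →
      ∀ x ∈ Icc u v, ‖g x‖ ≤ ‖g u‖ + 2 / (v - u) := by
    intro u hu v hv huv hlen x hx
    obtain ⟨A, B, hAB⟩ := IsFineDivision.exists_extend
      (fun u v x => f v - f u - (v - u) • g x) (δ := fun _ => δ) (fun _ _ => hδ) hu hv
    have key : ∀ z ∈ Icc u v, ‖A + (f v - f u - (v - u) • g z) + B‖ < 1 := by
      intro z hz
      obtain ⟨n, T, X, hT, e⟩ := hAB (isFineDivision_single hz.1 hz.2 (δ := fun _ => δ)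
        (by linarith [hz.2]) (by linarith [hz.1]))
      have := H n T X hT
      rw [e] at this
      simpa using this
    have h1 := key u ⟨le_rfl, huv.le⟩
    have h2 := key x hx
    have h3 : ‖(v - u) • (g x - g u)‖ ≤ 2 := by
      have e : (v - u) • (g x - g u) = (A + (f v - f u - (v - u) • g u) + B) -
          (A + (f v - f u - (v - u) • g x) + B) := by rw [smul_sub]; abel
      rw [e]
      exact (norm_sub_le _ _).trans (by linarith)
    rw [norm_smul, Real.norm_of_nonneg (by linarith), ← le_div_iff₀' (by linarith)] at h3
    have := norm_le_norm_add_norm_sub' (g x) (g u)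
    linarith
  refine isCompact_Icc.induction_on (p := fun s => ∃ M : ℝ, ∀ t ∈ s, ‖g t‖ ≤ M)
    ⟨0, by simp⟩ (fun s t hst ⟨M, hM⟩ => ⟨M, fun x hx => hM x (hst hx)⟩)
    (fun s t ⟨M, hM⟩ ⟨N, hN⟩ => ⟨max M N, fun x hx => hx.elim
      (fun h => (hM x h).trans (le_max_left _ _)) fun h => (hN x h).trans (le_max_right _ _)⟩) ?_
  intro x hx
  set u := max c (x - δ / 3) with hu
  set v := min d (x + δ / 3) with hv
  have huv : u < v := by
    rw [hu, hv, max_lt_iff, lt_min_iff, lt_min_iff]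
    exact ⟨⟨hcd, by linarith [hx.1]⟩, by linarith [hx.2], by linarith⟩
  refine ⟨Icc u v, ?_, ‖g u‖ + 2 / (v - u), interval_bound u ?_ v ?_ huv ?_⟩
  · rw [mem_nhdsWithin]
    refine ⟨Ioo (x - δ / 3) (x + δ / 3), isOpen_Ioo, ⟨by linarith, by linarith⟩, ?_⟩
    rintro y ⟨hy1, hy2⟩
    exact ⟨max_le hy2.1 hy1.1.le, le_min hy2.2 hy1.2.le⟩
  · exact ⟨le_max_left _ _, huv.le.trans (min_le_left _ _)⟩
  · exact ⟨(le_max_left _ _).trans huv.le, min_le_left _ _⟩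
  · have h1 : x - δ / 3 ≤ u := le_max_right _ _
    have h2 : v ≤ x + δ / 3 := min_le_right _ _
    linarith

/-- A bounded function which is continuous off a countable set is Riemann integrable. -/
lemma riemannIntegrableOn_of_bounded [CompleteSpace E] {g : ℝ → E} {c d M : ℝ} (hcd : c < d)
    {Z : Set ℝ} (hZ : Z.Countable) (hg : ∀ t ∈ Icc c d \ Z, ContinuousAt g t)
    (hM : ∀ t ∈ Icc c d, ‖g t‖ ≤ M) : RiemannIntegrableOn g c d := by
  have hM0 : 0 ≤ M := (norm_nonneg _).trans (hM c (left_mem_Icc.2 hcd.le))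
  have hint : IntegrableOn g (Icc c d) := integrableOn_Icc_of_bounded hZ hg hM
  have hii : ∀ u ∈ Icc c d, ∀ v ∈ Icc c d, IntervalIntegrable g volume u v := fun u hu v hv =>
    (hint.mono_set ((ordConnected_Icc).uIcc_subset hu hv)).intervalIntegrable
  refine ⟨fun t => ∫ s in c..t, g s, fun ε hε => ?_⟩
  set η := ε / (d - c + 2 * M + 1) with hη
  have hη0 : 0 < η := by
    have : 0 < d - c := sub_pos.2 hcd
    positivity
  obtain ⟨U, hZU, hUo, hUv⟩ := Z.exists_isOpen_lt_of_lt (μ := volume) (ENNReal.ofReal η)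
    (by rw [hZ.measure_zero]; simpa)
  -- `K` bounds the local oscillation of `g`: `η` off `U`, `η + 2 * M` on `U`. Its integral is at
  -- most `(d - c + 2 * M) * η < ε`.
  set K : ℝ → ℝ := fun s => η + 2 * M * U.indicator 1 s with hK
  have hK0 : ∀ s, η ≤ K s := fun s => by
    have : 0 ≤ U.indicator (1 : ℝ → ℝ) s := indicator_nonneg (by simp) s
    simp only [hK]; nlinarith
  have hUi : ∀ u v, IntervalIntegrable (U.indicator (1 : ℝ → ℝ)) volume u v := fun u v =>
    ⟨(integrableOn_const (C := (1 : ℝ)) (by simp)).indicator hUo.measurableSet,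
      (integrableOn_const (C := (1 : ℝ)) (by simp)).indicator hUo.measurableSet⟩
  have hKi : ∀ u v, IntervalIntegrable K volume u v := fun u v =>
    intervalIntegrable_const.add ((hUi u v).const_mul _)
  have hKint : ∫ s in c..d, K s < ε := by
    have h1 : ∫ s in c..d, U.indicator (1 : ℝ → ℝ) s ≤ η := by
      rw [intervalIntegral.integral_of_le hcd.le, integral_indicator_one hUo.measurableSet]
      refine ENNReal.toReal_le_of_le_ofReal hη0.le ?_
      exact (Measure.restrict_apply_le _ _).trans hUv.le
    have h2 : ∫ s in c..d, K s = (d - c) * η + 2 * M * ∫ s in c..d, U.indicator (1 : ℝ → ℝ) s := by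
      simp only [hK]
      rw [intervalIntegral.integral_add intervalIntegrable_const
        ((hUi c d).const_mul _)]
      simp
    have h3 : ε = (d - c + 2 * M + 1) * η := by
      have : 0 < d - c := sub_pos.2 hcd
      rw [hη]; field_simp
    nlinarith
  have hcov : ∀ x : Icc c d, ∃ O : Set ℝ, IsOpen O ∧ x.1 ∈ O ∧ ∀ s ∈ O ∩ Icc c d,
      ∀ r ∈ O ∩ Icc c d, ‖g s - g r‖ ≤ K s := by
    rintro ⟨x, hx⟩
    by_cases hxZ : x ∈ Z
    · refine ⟨U, hUo, hZU hxZ, fun s hs r hr => ?_⟩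
      have : K s = η + 2 * M := by simp [hK, hs.1]
      rw [this]
      linarith [norm_sub_le (g s) (g r), hM s hs.2, hM r hr.2]
    · obtain ⟨δ, hδ, H⟩ := Metric.continuousAt_iff.1 (hg x ⟨hx, hxZ⟩) (η / 2) (half_pos hη0)
      refine ⟨Metric.ball x δ, Metric.isOpen_ball, Metric.mem_ball_self hδ, fun s hs r hr => ?_⟩
      refine le_trans ?_ (hK0 s)
      rw [← dist_eq_norm]
      have := dist_triangle_right (g s) (g r) (g x)
      linarith [H hs.1, H hr.1]
  choose O hO hxO hOK using hcov
  -- By the Lebesgue number, each piece of a fine division lies in one `O x`, where `K` bounds the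
  -- oscillation.
  obtain ⟨δ, hδ, hleb⟩ := lebesgue_number_lemma_of_metric (isCompact_Icc (a := c) (b := d)) hO
    fun x hx => mem_iUnion.2 ⟨⟨x, hx⟩, hxO ⟨x, hx⟩⟩
  refine ⟨δ, hδ, fun m t ξ hdiv => lt_of_le_of_lt ?_ hKint⟩
  calc _ ≤ ∑ i ∈ Finset.range m, ∫ s in (t i)..(t (i + 1)), K s := by
        refine (norm_sum_le _ _).trans (Finset.sum_le_sum fun i hi => ?_)
        have hi := Finset.mem_range.1 hi
        have hti := hdiv.mem_Icc hi.le
        have hti' := hdiv.mem_Icc (i := i + 1) hi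
        have hc : c ∈ Icc c d := left_mem_Icc.2 hcd.le
        have hle := hdiv.le i hi
        obtain ⟨x, hx⟩ := hleb (ξ i) (hdiv.tag_mem_Icc hi)
        rw [Real.ball_eq_Ioo] at hx
        have hsub := (hdiv.fine i hi).trans hx
        rw [intervalIntegral.integral_interval_sub_left (hii _ hc _ hti') (hii _ hc _ hti),
          ← intervalIntegral.integral_const,
          ← intervalIntegral.integral_sub (hii _ hti _ hti') intervalIntegrable_const]
        refine intervalIntegral.norm_integral_le_of_norm_le hle (Eventually.of_forall ?_)
          (hKi _ _)
        intro s hs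
        have hs' := Ioc_subset_Icc_self hs
        exact hOK x s ⟨hsub hs', hti.1.trans hs'.1, hs'.2.trans hti'.2⟩ (ξ i)
          ⟨hsub (hdiv.tag_mem i hi), hdiv.tag_mem_Icc hi⟩
    _ = ∫ s in c..d, K s := by
        rw [intervalIntegral.sum_integral_adjacent_intervals fun k _ => hKi _ _, hdiv.left,
          hdiv.right]

end Riemann

/-! ### Countability of the discontinuities -/

section Discontinuities

/-- A function has only countably many discontinuities at which a right limit exists. -/
lemma countable_discontinuities_of_right_limit {X : Type*} [PseudoMetricSpace X] (g : ℝ → X) :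
    {t | (∃ l, Tendsto g (𝓝[>] t) (𝓝 l)) ∧ ¬ContinuousAt g t}.Countable := by
  set D : ℕ → Set ℝ := fun n => {t | (∃ l, Tendsto g (𝓝[>] t) (𝓝 l)) ∧
    ¬∃ U ∈ 𝓝 t, ∀ x ∈ U, ∀ y ∈ U, dist (g x) (g y) < 1 / ((n : ℝ) + 1)} with hD
  have hDc : ∀ n, (D n).Countable := by
    intro n
    refine (countable_setOfPred_isolated_right_within (s := D n)).mono fun t ht => ?_
    -- Just to the right of `t` the values of `g` are close to `l`, so no point there lies in `D n`:
    -- every point of `D n` is isolated from the right.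
    suffices 𝓝[D n ∩ Ioi t] t = ⊥ from ⟨ht, this⟩
    obtain ⟨l, hl⟩ := ht.1
    have hε : (0 : ℝ) < 1 / ((n : ℝ) + 1) / 2 := by positivity
    obtain ⟨u, hu, hsub⟩ := mem_nhdsGT_iff_exists_Ioo_subset.1
      (hl (Metric.ball_mem_nhds l hε))
    rw [← empty_mem_iff_bot, mem_nhdsWithin_iff_exists_mem_nhds_inter]
    refine ⟨Iio u, Iio_mem_nhds hu, ?_⟩
    rintro x ⟨hxu, hxD, htx⟩
    refine hxD.2 ⟨Ioo t u, Ioo_mem_nhds htx hxu, fun y hy z hz => ?_⟩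
    have h1 : dist (g y) l < _ := hsub hy
    have h2 : dist (g z) l < _ := hsub hz
    linarith [dist_triangle_right (g y) (g z) l]
  refine (countable_iUnion hDc).mono ?_
  rintro t ⟨hl, hc⟩
  by_contra hcon
  simp only [mem_iUnion, not_exists] at hcon
  refine hc (Metric.continuousAt_iff'.2 fun ε hε => ?_)
  obtain ⟨n, hn⟩ := exists_nat_one_div_lt hε
  obtain ⟨U, hU, H⟩ := not_not.1 fun h => hcon n ⟨hl, h⟩
  filter_upwards [hU] with x hx using (H x hx t (mem_of_mem_nhds hU)).trans hn

/-- Adding the endpoints of `J` to the exceptional set removes the points where two-sided continuity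
would involve values of `g` outside `J`, and those where no right limit is assumed. -/
lemma exists_countable_exceptional {X : Type*} [PseudoMetricSpace X] {J : Set ℝ} {g : ℝ → X}
    (h : ∀ t ∈ J, (∃ s ∈ J, t < s) → ∃ l, Tendsto g (𝓝[>] t) (𝓝 l)) :
    ∃ Z ⊆ J, Z.Countable ∧
      ∀ t ∈ J \ Z, ContinuousAt g t ∧ (∃ s ∈ J, s < t) ∧ ∃ s ∈ J, t < s := by
  refine ⟨({t | (∃ l, Tendsto g (𝓝[>] t) (𝓝 l)) ∧ ¬ContinuousAt g t} ∩ J) ∪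
    ({t ∈ J | ¬∃ s ∈ J, s < t} ∪ {t ∈ J | ¬∃ s ∈ J, t < s}), ?_, ?_, ?_⟩
  · rintro t (ht | ht | ht)
    exacts [ht.2, ht.1, ht.1]
  · refine ((countable_discontinuities_of_right_limit g).mono inter_subset_left).union
      (Countable.union ?_ ?_)
    · refine Subsingleton.countable fun s hs t ht => le_antisymm ?_ ?_
      · exact not_lt.1 fun hlt => hs.2 ⟨t, ht.1, hlt⟩
      · exact not_lt.1 fun hlt => ht.2 ⟨s, hs.1, hlt⟩
    · refine Subsingleton.countable fun s hs t ht => le_antisymm ?_ ?_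
      · exact not_lt.1 fun hlt => ht.2 ⟨s, hs.1, hlt⟩
      · exact not_lt.1 fun hlt => hs.2 ⟨t, ht.1, hlt⟩
  · rintro t ⟨htJ, htZ⟩
    simp only [mem_union, mem_inter_iff, mem_ofPred_eq, not_or, not_and, not_not] at htZ
    obtain ⟨h1, h2, h3⟩ := htZ
    refine ⟨?_, h2 htJ, h3 htJ⟩
    by_contra hc
    exact h1 ⟨h t htJ (h3 htJ), hc⟩ htJ

end Discontinuities

/-! ### Gluing on `J` and the integral primitive -/

section Primitives

variable {E : Type*} [NormedAddCommGroup E] [NormedSpace ℝ E]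

lemma continuousOn_of_forall_Icc {X : Type*} [TopologicalSpace X] {f : ℝ → X} {J : Set ℝ} {a : ℝ}
    (ha : IsLeast J a) (h : ∀ d ∈ J, a < d → ContinuousOn f (Icc a d)) : ContinuousOn f J := by
  intro t ht
  by_cases hs : ∃ s ∈ J, t < s
  · obtain ⟨s, hsJ, hts⟩ := hs
    refine (h s hsJ ((ha.2 ht).trans_lt hts) t ⟨ha.2 ht, hts.le⟩).mono_of_mem_nhdsWithin ?_
    filter_upwards [self_mem_nhdsWithin, mem_nhdsWithin_of_mem_nhds (Iio_mem_nhds hts)]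
      with x hxJ hx using ⟨ha.2 hxJ, le_of_lt hx⟩
  · push Not at hs
    rcases (ha.2 ht).eq_or_lt with rfl | hat
    · exact continuousWithinAt_singleton.mono fun x hx => le_antisymm (hs x hx) (ha.2 hx)
    · exact (h t ht hat t ⟨hat.le, le_rfl⟩).mono fun x hx => ⟨ha.2 hx, hs x hx⟩

/-- HL primitives on the intervals `[a, d]` are glued to a CD primitive. -/
lemma exists_isCDPrimitive_of_locallyHLIntegrable {J : Set ℝ} {a : ℝ} {g : ℝ → E}
    (hJ : J.OrdConnected) (ha : IsLeast J a) {Z : Set ℝ} (hZJ : Z ⊆ J) (hZ : Z.Countable)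
    (hg : ∀ t ∈ J \ Z, ContinuousAt g t ∧ (∃ s ∈ J, s < t) ∧ ∃ s ∈ J, t < s)
    (h : LocallyHLIntegrable J g) : ∃ f, IsCDPrimitive J g f := by
  have hF : ∀ d, ∃ F : ℝ → E, d ∈ J → a < d → IsHLPrimitive g F a d := by
    intro d
    by_cases hd : d ∈ J ∧ a < d
    · obtain ⟨F, hF⟩ := h a d hd.2 (hJ.out ha.1 hd.1)
      exact ⟨F, fun _ _ => hF⟩
    · exact ⟨0, fun h1 h2 => absurd ⟨h1, h2⟩ hd⟩
  choose F hF using hF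
  have hglue : ∀ d ∈ J, a < d → ∀ x ∈ Icc a d, F x x - F x a = F d x - F d a := by
    intro d hd had x hx
    rcases hx.1.eq_or_lt with rfl | hax
    · simp
    · exact (hF x (hJ.out ha.1 hd hx) hax).sub_eq_sub (hF d hd had) hx.1 ⟨le_rfl, hx.1⟩
        ⟨hx.1, le_rfl⟩ ⟨le_rfl, had.le⟩ hx
  -- The diagonal value, normalised to vanish at `a`, agrees on `[a, d]` with `F d - F d a` by
  -- uniqueness of increments. `F a` is arbitrary, but the value at `a` is `0` anyway.
  refine ⟨fun x => F x x - F x a, continuousOn_of_forall_Icc ha fun d hd had => ?_,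
    Z, hZJ, hZ, fun t ht => ?_⟩
  · exact ((hF d hd had).continuousOn.sub continuousOn_const).congr (hglue d hd had)
  · obtain ⟨hc, ⟨s, hs, hst⟩, d, hd, htd⟩ := hg t ht
    have hat : a < t := (ha.2 hs).trans_lt hst
    have hder := ((hF d hd (hat.trans htd)).hasDerivAt ⟨hat, htd⟩ hc).sub_const (F d a)
    refine (hder.congr_of_eventuallyEq ?_).hasDerivWithinAt
    filter_upwards [Icc_mem_nhds hat htd] with x hx using hglue d hd (hat.trans htd) x hx

lemma IsCDPrimitive.locallyHLIntegrable {J : Set ℝ} {g f : ℝ → E} (h : IsCDPrimitive J g f) :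
    LocallyHLIntegrable J g := by
  obtain ⟨hf, Z, -, hZ, hd⟩ := h
  intro c d hcd hsub
  exact ⟨f, isHLPrimitive_of_hasDerivWithinAt hcd.le (hf.mono hsub) hZ
    fun x hx => (hd x ⟨hsub hx.1, hx.2⟩).mono hsub⟩

lemma LocallyBochnerIntegrable.intervalIntegrable {E : Type*} [NormedAddCommGroup E] {J : Set ℝ}
    {a x : ℝ} {g : ℝ → E}
    (hJ : J.OrdConnected) (ha : IsLeast J a) (h : LocallyBochnerIntegrable J g) (hx : x ∈ J) :
    IntervalIntegrable g volume a x := by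
  rcases (ha.2 hx).eq_or_lt with rfl | hax
  · exact IntervalIntegrable.refl
  · exact (intervalIntegrable_iff_integrableOn_Icc_of_le hax.le).2 (h a x hax (hJ.out ha.1 hx))

lemma LocallyBochnerIntegrable.locallyAC_integral {J : Set ℝ} {a : ℝ} {g : ℝ → E}
    (hJ : J.OrdConnected) (ha : IsLeast J a) (h : LocallyBochnerIntegrable J g) :
    LocallyAC J fun x => ∫ s in a..x, g s := fun c d hcd hsub =>
  absolutelyContinuousOnInterval_integral fun x hx =>
    h.intervalIntegrable hJ ha (hsub (by rwa [uIcc_of_le hcd.le] at hx))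

lemma LocallyBochnerIntegrable.isCDPrimitive_integral [CompleteSpace E] {J : Set ℝ} {a : ℝ}
    {g : ℝ → E} (hJ : J.OrdConnected) (ha : IsLeast J a) {Z : Set ℝ} (hZJ : Z ⊆ J)
    (hZ : Z.Countable)
    (hg : ∀ t ∈ J \ Z, ContinuousAt g t ∧ (∃ s ∈ J, s < t) ∧ ∃ s ∈ J, t < s)
    (h : LocallyBochnerIntegrable J g) : IsCDPrimitive J g fun x => ∫ s in a..x, g s := by
  refine ⟨continuousOn_of_forall_Icc ha fun d hd had => ?_, Z, hZJ, hZ, fun t ht => ?_⟩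
  · rw [← uIcc_of_le had.le]
    exact (h.locallyAC_integral hJ ha a d had (hJ.out ha.1 hd)).continuousOn
  · obtain ⟨hc, ⟨s, hs, hst⟩, d, hd, htd⟩ := hg t ht
    have hat : a < t := (ha.2 hs).trans_lt hst
    exact (intervalIntegral.integral_hasDerivAt_right (h.intervalIntegrable hJ ha ht.1)
      ⟨Icc a d, Icc_mem_nhds hat htd,
        (h a d (hat.trans htd) (hJ.out ha.1 hd)).aestronglyMeasurable⟩ hc).hasDerivWithinAt

lemma IsCDPrimitive.locallyBochnerIntegrable {J : Set ℝ} {g f : ℝ → E} {Z : Set ℝ}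
    (hZ : Z.Countable) (hg : ∀ t ∈ J \ Z, ContinuousAt g t)
    (h : IsCDPrimitive J g f) (hf : LocallyAC J f) : LocallyBochnerIntegrable J g := by
  obtain ⟨-, Y, -, hY, hd⟩ := h
  intro c d hcd hsub
  exact integrableOn_of_absolutelyContinuousOnInterval hcd.le (hf c d hcd hsub) hY
    (fun x hx => (hd x ⟨hsub hx.1, hx.2⟩).mono hsub)
    (aestronglyMeasurable_of_continuousAt measurableSet_Icc hZ
      fun t ht => hg t ⟨hsub ht.1, ht.2⟩)

lemma LocallyBdd.locallyBochnerIntegrable {E : Type*} [NormedAddCommGroup E] {J : Set ℝ} {g : ℝ → E} {Z : Set ℝ}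
    (hZ : Z.Countable) (hg : ∀ t ∈ J \ Z, ContinuousAt g t) (h : LocallyBdd J g) :
    LocallyBochnerIntegrable J g := fun c d hcd hsub =>
  (h c d hcd hsub).elim fun _ hM =>
    integrableOn_Icc_of_bounded hZ (fun t ht => hg t ⟨hsub ht.1, ht.2⟩) hM

lemma LocallyBdd.locallyLip_integral {J : Set ℝ} {a : ℝ} {g : ℝ → E} (hJ : J.OrdConnected)
    (ha : IsLeast J a) (h : LocallyBdd J g) (hi : LocallyBochnerIntegrable J g) :
    LocallyLip J fun x => ∫ s in a..x, g s := by
  intro c d hcd hsub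
  obtain ⟨M, hM⟩ := h c d hcd hsub
  refine ⟨M.toNNReal, LipschitzOnWith.of_dist_le_mul fun x hx y hy => ?_⟩
  rw [dist_eq_norm, intervalIntegral.integral_interval_sub_left
    (hi.intervalIntegrable hJ ha (hsub hx)) (hi.intervalIntegrable hJ ha (hsub hy)),
    Real.dist_eq]
  refine intervalIntegral.norm_integral_le_of_norm_le_const fun s hs => ?_
  exact (hM s (ordConnected_Icc.uIcc_subset hy hx (uIoc_subset_uIcc hs))).trans
    (Real.le_coe_toNNReal M)

end Primitives

/-! ### Passage from extended reals to reals -/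

section ExtendedReals

lemma tendsto_coe_nhdsGT (t : ℝ) : Tendsto ((↑) : ℝ → EReal) (𝓝[>] t) (𝓝[>] (t : EReal)) :=
  tendsto_nhdsWithin_iff.2
    ⟨continuous_coe_real_ereal.continuousAt.tendsto.mono_left nhdsWithin_le_nhds,
      by filter_upwards [self_mem_nhdsWithin] with x hx using EReal.coe_lt_coe_iff.2 hx⟩

lemma ordConnected_realPart {I : Set EReal} (hI : I.OrdConnected) :
    (realPart I).OrdConnected :=
  ⟨fun _ hx _ hy _ hz => hI.out hx hy
    ⟨EReal.coe_le_coe_iff.2 hz.1, EReal.coe_le_coe_iff.2 hz.2⟩⟩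

lemma isLeast_realPart {I : Set EReal} {a : ℝ} (ha : IsLeast I (a : EReal)) :
    IsLeast (realPart I) a :=
  ⟨ha.1, fun _ hx => EReal.coe_le_coe_iff.1 (ha.2 hx)⟩

lemma IsRightRegulated.exists_tendsto_nhdsGT {X : Type*} [TopologicalSpace X] {I : Set EReal}
    {g : EReal → X} (hg : IsRightRegulated I g) {t : ℝ} (ht : t ∈ realPart I)
    (h : ∃ s ∈ realPart I, t < s) :
    ∃ l, Tendsto (fun x : ℝ => g x) (𝓝[>] t) (𝓝 l) := by
  obtain ⟨s, hs, hts⟩ := h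
  obtain ⟨l, hl⟩ := hg t ht ((EReal.coe_lt_coe_iff.2 hts).trans_le (le_sSup hs)).ne
  exact ⟨l, hl.comp (tendsto_coe_nhdsGT t)⟩

end ExtendedReals

end RightRegulated

theorem theorem4p1 {E : Type*} [NormedAddCommGroup E] [NormedSpace ℝ E] [CompleteSpace E]
    (I : Set EReal) (hI : I.OrdConnected) (a : ℝ) (ha : IsLeast I (a : EReal))
    (hlt : (a : EReal) < sSup I)
    (g : EReal → E) (hg : RightRegulated.IsRightRegulated I g) :
    (RightRegulated.LocallyHLIntegrable (RightRegulated.realPart I) (fun t : ℝ => g t) ↔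
      ∃ f : ℝ → E,
        RightRegulated.IsCDPrimitive (RightRegulated.realPart I) (fun t : ℝ => g t) f) ∧
    (RightRegulated.LocallyBochnerIntegrable (RightRegulated.realPart I) (fun t : ℝ => g t) ↔
      ∃ f : ℝ → E,
        RightRegulated.IsCDPrimitive (RightRegulated.realPart I) (fun t : ℝ => g t) f ∧
        RightRegulated.LocallyAC (RightRegulated.realPart I) f) ∧
    (RightRegulated.LocallyRiemannIntegrable (RightRegulated.realPart I) (fun t : ℝ => g t) ↔
      RightRegulated.LocallyBdd (RightRegulated.realPart I) (fun t : ℝ => g t)) ∧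
    (RightRegulated.LocallyBdd (RightRegulated.realPart I) (fun t : ℝ => g t) →
      ∃ f : ℝ → E,
        RightRegulated.IsCDPrimitive (RightRegulated.realPart I) (fun t : ℝ => g t) f ∧
        RightRegulated.LocallyLip (RightRegulated.realPart I) f) := by
  have hJ := RightRegulated.ordConnected_realPart hI
  have haJ := RightRegulated.isLeast_realPart ha
  obtain ⟨Z, hZJ, hZ, hZg⟩ := RightRegulated.exists_countable_exceptional
    (J := RightRegulated.realPart I) (g := fun t : ℝ => g t)
    fun t ht hs => hg.exists_tendsto_nhdsGT ht hs
  have hcont := fun t ht => (hZg t ht).1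
  refine ⟨⟨fun h => RightRegulated.exists_isCDPrimitive_of_locallyHLIntegrable hJ haJ hZJ hZ hZg h,
      fun ⟨f, hf⟩ => hf.locallyHLIntegrable⟩,
    ⟨fun h => ⟨_, h.isCDPrimitive_integral hJ haJ hZJ hZ hZg, h.locallyAC_integral hJ haJ⟩,
      fun ⟨f, hf, hac⟩ => hf.locallyBochnerIntegrable hZ hcont hac⟩,
    ⟨fun h c d hcd hsub => (h c d hcd hsub).exists_bound hcd, fun h c d hcd hsub => ?_⟩,
    fun h => ?_⟩
  · obtain ⟨M, hM⟩ := h c d hcd hsub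
    exact RightRegulated.riemannIntegrableOn_of_bounded hcd hZ
      (fun t ht => hcont t ⟨hsub ht.1, ht.2⟩) hM
  · have hi := h.locallyBochnerIntegrable hZ hcont
    exact ⟨_, hi.isCDPrimitive_integral hJ haJ hZJ hZ hZg, h.locallyLip_integral hJ haJ hi⟩
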